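/- Let $G$ be a finite simple graph on $n$ vertices whose independence number satisfies $\alpha(G)\le 2$. Let $P_4$ be the path on four vertices and let $K_3^e$ be the four-vertex graph consisting of a triangle together with a fourth vertex adjacent to exactly one vertex of the triangle. If $G$ has no induced subgraph isomorphic to $P_4$, or $G$ has no induced subgraph isomorphic to $K_3^e$, then $G$ contains the complete graph $K_{\lceil n/2\rceil}$ as an immersion; that is, with $H=K_{\lceil n/2\rceil}$, there are an injective map $\phi\colon V(H)\to V(G)$ and, for every edge $uv\in E(H)$, a path $P_{uv}$ in $G$ with endpoints $\phi(u)$ and $\phi(v)$, such that the paths $P_{uv}$ ($uv\in E(H)$) are pairwise edge-disjoint and no vertex of $\phi(V(H))$ is an interior vertex of any path $P_{uv}$. -/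

import Mathlib

/-- `G.ContainsImmersion H`: the graph `G` contains the graph `H` as an immersion. There are an
injection `φ` of the vertices of `H` into those of `G` and, for every edge `uv` of `H`, a path
`P u v` in `G` from `φ u` to `φ v` such that paths of distinct edges share no edge, and no branch
vertex `φ w` is an interior vertex of any of the paths. The path of an edge is recorded for both
orientations of that edge, `P v u` being `P u v` traversed backwards. -/
def SimpleGraph.ContainsImmersion {V W : Type*} (G : SimpleGraph V) (H : SimpleGraph W) : Prop :=
  ∃ (φ : W ↪ V) (P : ∀ u v : W, H.Adj u v → G.Walk (φ u) (φ v)),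
    (∀ u v (h : H.Adj u v), (P u v h).IsPath) ∧
    (∀ u v (h : H.Adj u v), P v u h.symm = (P u v h).reverse) ∧
    (∀ u v (h : H.Adj u v) u' v' (h' : H.Adj u' v'), s(u, v) ≠ s(u', v') →
      (P u v h).edges.Disjoint (P u' v' h').edges) ∧
    (∀ u v (h : H.Adj u v) w, φ w ∈ (P u v h).support → w = u ∨ w = v)

/-- `G.InducedFree H`: no induced subgraph of `G` is isomorphic to `H`. -/
def SimpleGraph.InducedFree {V W : Type*} (G : SimpleGraph V) (H : SimpleGraph W) : Prop :=
  ¬ H.IsIndContained G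

/-- The graph `K₃ᵉ`: a triangle `0 1 2` together with a further vertex `3` that is joined by a
pendant edge to the vertex `2` only. -/
def triangleWithPendantEdge : SimpleGraph (Fin 4) :=
  SimpleGraph.fromEdgeSet {s(0, 1), s(0, 2), s(1, 2), s(2, 3)}

/-!
Let `F` be the complement of `G`. It is triangle-free because `α(G) ≤ 2`. If `F` is 2-colourable,
one of its colour classes is a clique of `G` with at least `n / 2` vertices. An odd walk of a
`P₄`-free graph can be shortened by two edges at a time until it is a single edge, so it is never
closed; as `P₄` is self-complementary, this settles the first case. The complement of `K₃ᵉ` is a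
path on three vertices plus an isolated vertex; when `F` does not contain it, an induced path
`a b c d` of `F` either closes up to a five-cycle, which must then contain every vertex, or every
vertex is adjacent to `b` or to `c`, which gives a 2-colouring. Finally, a graph on five vertices
with `α ≤ 2` is not a forest, and a cycle is a subdivided triangle.
-/

open SimpleGraph

section Immersion

variable {V W : Type*} {G : SimpleGraph V} {H : SimpleGraph W}

theorem containsImmersion_of_isContained (h : H ⊑ G) : G.ContainsImmersion H := by
  obtain ⟨f⟩ := h
  have adj {u v : W} (h : H.Adj u v) : G.Adj (f.toEmbedding u) (f.toEmbedding v) :=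
    f.toHom.map_adj h
  refine ⟨f.toEmbedding, fun u v h => (adj h).toWalk, fun u v h => (adj h).isPath_toWalk,
    fun u v h => rfl, ?_, ?_⟩
  · intro u v h u' v' h' hne
    rw [Adj.edges_toWalk, Adj.edges_toWalk, List.disjoint_singleton, List.mem_singleton]
    exact (Sym2.map.injective f.toEmbedding.injective).ne hne.symm
  · intro u v h w hw
    simpa using hw

theorem containsImmersion_of_lt [LinearOrder W] (φ : W ↪ V)
    (Q : ∀ u v : W, H.Adj u v → u < v → G.Walk (φ u) (φ v))
    (isPath : ∀ u v h hlt, (Q u v h hlt).IsPath)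
    (disjoint : ∀ u v h hlt u' v' h' hlt', (u, v) ≠ (u', v') →
      (Q u v h hlt).edges.Disjoint (Q u' v' h' hlt').edges)
    (eq_or_eq : ∀ u v h hlt w, φ w ∈ (Q u v h hlt).support → w = u ∨ w = v) :
    G.ContainsImmersion H := by
  have gt_of_not_lt {u v : W} (h : H.Adj u v) (hlt : ¬ u < v) : v < u :=
    lt_of_le_of_ne (not_lt.mp hlt) h.ne'
  refine ⟨φ, fun u v h => if hlt : u < v then Q u v h hlt
    else (Q v u h.symm (gt_of_not_lt h hlt)).reverse, ?_, ?_, ?_, ?_⟩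
  · intro u v h
    dsimp only
    split_ifs
    · exact isPath ..
    · exact (isPath ..).reverse
  · intro u v h
    rcases h.ne.lt_or_gt with hlt | hlt <;> simp [hlt, hlt.not_gt]
  · intro u v h u' v' h' hne
    obtain ⟨hne₁, hne₂⟩ : (u, v) ≠ (u', v') ∧ (u, v) ≠ (v', u') := by
      simpa only [ne_eq, Sym2.eq_iff, not_or, Prod.mk.injEq] using hne
    have hne₃ : (v, u) ≠ (u', v') := fun e => hne₂ (Prod.swap_inj.mp e)
    have hne₄ : (v, u) ≠ (v', u') := fun e => hne₁ (Prod.swap_inj.mp e)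
    dsimp only
    split_ifs <;> try simp only [Walk.edges_reverse, List.disjoint_reverse_left,
      List.disjoint_reverse_right]
    exacts [disjoint _ _ _ _ _ _ _ _ hne₁, disjoint _ _ _ _ _ _ _ _ hne₂,
      disjoint _ _ _ _ _ _ _ _ hne₃, disjoint _ _ _ _ _ _ _ _ hne₄]
  · intro u v h w hw
    dsimp only at hw
    split_ifs at hw
    · exact eq_or_eq _ _ _ _ _ hw
    · rw [Walk.support_reverse, List.mem_reverse] at hw
      exact (eq_or_eq _ _ _ _ _ hw).symm

theorem containsImmersion_completeGraph_three_of_isPath (φ : Fin 3 ↪ V)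
    (h01 : G.Adj (φ 0) (φ 1)) (h12 : G.Adj (φ 1) (φ 2)) {p : G.Walk (φ 2) (φ 0)} (hp : p.IsPath)
    (hsupport : φ 1 ∉ p.support) : G.ContainsImmersion (completeGraph (Fin 3)) := by
  let Q : ∀ i j : Fin 3, (completeGraph (Fin 3)).Adj i j → i < j → G.Walk (φ i) (φ j)
    | 0, 1, _, _ => h01.toWalk
    | 1, 2, _, _ => h12.toWalk
    | 0, 2, _, _ => p.reverse
    | 0, 0, _, h | 1, 0, _, h | 1, 1, _, h | 2, 0, _, h | 2, 1, _, h | 2, 2, _, h =>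
      absurd h (by decide)
  have lt_cases : ∀ {i j : Fin 3}, i < j → i = 0 ∧ j = 1 ∨ i = 1 ∧ j = 2 ∨ i = 0 ∧ j = 2 := by
    decide
  have h01_notMem : s(φ 0, φ 1) ∉ p.edges := fun h => hsupport (p.snd_mem_support_of_mem_edges h)
  have h12_notMem : s(φ 1, φ 2) ∉ p.edges := fun h => hsupport (p.fst_mem_support_of_mem_edges h)
  refine containsImmersion_of_lt φ Q ?_ ?_ ?_
  · intro i j _ hlt
    rcases lt_cases hlt with ⟨rfl, rfl⟩ | ⟨rfl, rfl⟩ | ⟨rfl, rfl⟩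
    exacts [h01.isPath_toWalk, h12.isPath_toWalk, hp.reverse]
  · intro i j _ hlt i' j' _ hlt' hne
    rcases lt_cases hlt with ⟨rfl, rfl⟩ | ⟨rfl, rfl⟩ | ⟨rfl, rfl⟩ <;>
      rcases lt_cases hlt' with ⟨rfl, rfl⟩ | ⟨rfl, rfl⟩ | ⟨rfl, rfl⟩ <;>
      simp_all [Q]
  · intro i j _ hlt k hk
    rcases lt_cases hlt with ⟨rfl, rfl⟩ | ⟨rfl, rfl⟩ | ⟨rfl, rfl⟩ <;> fin_cases k <;>
      simp_all [Q]

theorem containsImmersion_completeGraph_three_of_not_isAcyclic (hG : ¬ G.IsAcyclic) :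
    G.ContainsImmersion (completeGraph (Fin 3)) := by
  obtain ⟨u, c, hc⟩ : ∃ (u : V) (c : G.Walk u u), c.IsCycle := by
    simpa only [IsAcyclic, not_forall, not_not] using hG
  match c, hc with
  | .nil, hc => exact absurd hc Walk.not_isCycle_nil
  | .cons huu .nil, _ => exact absurd rfl huu.ne
  | .cons (v := v) huv (.cons (v := w) hvw p), hc =>
    rw [Walk.cons_isCycle_iff, Walk.cons_isPath_iff] at hc
    obtain ⟨⟨hp, hv⟩, huv_notMem⟩ := hc
    have huw : u ≠ w := by
      rintro rfl
      exact huv_notMem (by simp [Sym2.eq_swap])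
    have hinj : Function.Injective ![u, v, w] := by
      simp [Function.Injective, Fin.forall_fin_succ, huv.ne, huv.ne', hvw.ne, hvw.ne', huw,
        huw.symm]
    exact containsImmersion_completeGraph_three_of_isPath ⟨_, hinj⟩ huv hvw hp hv

theorem completeGraph_isContained_of_le_cliqueNum {m : ℕ} (hm : m ≤ G.cliqueNum) :
    completeGraph (Fin m) ⊑ G := by
  obtain ⟨s, hs⟩ := G.exists_isNClique_cliqueNum
  exact (not_cliqueFree_iff_top_isContained m).mp fun h => hs.not_cliqueFree (h.mono hm)

end Immersion

section Coloring

variable {V : Type*} {F : SimpleGraph V}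

theorem card_le_mul_indepNum_of_colorable [Fintype V] {k : ℕ} (hF : F.Colorable k) :
    Fintype.card V ≤ k * F.indepNum := by
  obtain ⟨C⟩ := hF
  have card_colorClass_le (i : Fin k) : (Finset.univ.filter (C · = i)).card ≤ F.indepNum := by
    have hindep : F.IsIndepSet ((Finset.univ.filter (C · = i) : Finset V) : Set V) := by
      simpa [Coloring.colorClass] using C.isIndepSet_colorClass i
    exact hindep.card_le_indepNum
  simpa [mul_comm] using Finset.card_le_mul_card_image_of_maps_to
    (fun v _ => Finset.mem_univ (C v)) F.indepNum fun i _ => card_colorClass_le i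

theorem cliqueFree_of_cliqueNum_lt [Finite V] {k : ℕ} (h : F.cliqueNum < k) : F.CliqueFree k :=
  fun _ hs => h.not_ge (hs.card_eq ▸ hs.isClique.card_le_cliqueNum)

theorem not_adj_of_cliqueFree_three (hF : F.CliqueFree 3) {a b c : V} (hab : F.Adj a b)
    (hbc : F.Adj b c) : ¬ F.Adj a c := fun hac =>
  isIndepSet_neighborSet_of_triangleFree F hF b hab.symm hbc hac.ne hac

theorem colorable_two_of_forall_adj_or_adj (hF : F.CliqueFree 3) {b c : V}
    (h : ∀ x, F.Adj b x ∨ F.Adj c x) : F.Colorable 2 := by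
  classical
  refine (Coloring.mk (fun x => decide (F.Adj b x)) fun {x y} hxy => ?_).colorable
  have hb : F.Adj b x → ¬ F.Adj b y := fun hbx => not_adj_of_cliqueFree_three hF hbx hxy
  have hc : F.Adj c x → ¬ F.Adj c y := fun hcx => not_adj_of_cliqueFree_three hF hcx hxy
  grind

theorem adj_of_odd_length
    (hF : ∀ a b c d, F.Adj a b → F.Adj b c → F.Adj c d → F.Adj a d) {u v : V} (p : F.Walk u v)
    (hp : Odd p.length) : F.Adj u v := by
  match p, hp with
  | .cons huv .nil, _ => exact huv
  | .cons hua (.cons hab p), hp =>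
    rw [Walk.length_cons, Walk.length_cons] at hp
    have hbv := adj_of_odd_length hF p (by grind)
    exact hF _ _ _ _ hua hab hbv

theorem colorable_two_of_adj_of_walk_three
    (hF : ∀ a b c d, F.Adj a b → F.Adj b c → F.Adj c d → F.Adj a d) : F.Colorable 2 :=
  two_colorable_iff_forall_loop_even.mpr fun _ p =>
    Nat.not_odd_iff_even.mp fun hp => (adj_of_odd_length hF p hp).ne rfl

end Coloring

section InducedFree

variable {V W : Type*} {F : SimpleGraph V}

theorem inducedFree_compl_compl_iff {H : SimpleGraph W} :
    Fᶜ.InducedFree Hᶜ ↔ F.InducedFree H :=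
  not_congr compl_isIndContained_compl

theorem isIndContained_of_lt [LinearOrder W] {H : SimpleGraph W} (f : W → V)
    (hne : ∀ i j, i < j → f i ≠ f j) (hadj : ∀ i j, i < j → (F.Adj (f i) (f j) ↔ H.Adj i j)) :
    H ⊴ F := by
  refine ⟨⟨⟨f, .of_lt_imp_ne hne⟩, fun {i j} => ?_⟩⟩
  rcases lt_trichotomy i j with hij | rfl | hji
  · exact hadj i j hij
  · simp
  · rw [F.adj_comm, H.adj_comm]
    exact hadj j i hji

theorem pathGraph_four_compl_isIndContained : (pathGraph 4)ᶜ ⊴ pathGraph 4 := by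
  refine isIndContained_of_lt ![1, 3, 0, 2] (by decide) ?_
  simp only [pathGraph_adj, compl_adj]
  decide

theorem adj_of_walk_three_of_inducedFree_pathGraph (hF : F.CliqueFree 3)
    (hfree : F.InducedFree (pathGraph 4)) (a b c d : V) (hab : F.Adj a b) (hbc : F.Adj b c)
    (hcd : F.Adj c d) : F.Adj a d := by
  by_contra had
  have hac := not_adj_of_cliqueFree_three hF hab hbc
  have hbd := not_adj_of_cliqueFree_three hF hbc hcd
  have hac_ne : a ≠ c := by rintro rfl; exact had hcd
  have hbd_ne : b ≠ d := by rintro rfl; exact had hab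
  have had_ne : a ≠ d := by rintro rfl; exact hac hcd.symm
  refine hfree (isIndContained_of_lt ![a, b, c, d] ?_ ?_)
  · simp [Fin.forall_fin_succ, hab.ne, hbc.ne, hcd.ne, hac_ne, hbd_ne, had_ne]
  · simp [Fin.forall_fin_succ, pathGraph_adj, hab, hbc, hcd, hac, hbd, had]

theorem adj_of_path_two_of_inducedFree_triangleWithPendantEdge_compl (hF : F.CliqueFree 3)
    (hfree : F.InducedFree triangleWithPendantEdgeᶜ) {a b c d : V} (hab : F.Adj a b)
    (hbc : F.Adj b c) (hac_ne : a ≠ c) (hdb_ne : d ≠ b) :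
    F.Adj d a ∨ F.Adj d b ∨ F.Adj d c := by
  by_contra! ⟨hda, hdb, hdc⟩
  have hda_ne : d ≠ a := by rintro rfl; exact hdb hab
  have hdc_ne : d ≠ c := by rintro rfl; exact hdb hbc.symm
  have hac := not_adj_of_cliqueFree_three hF hab hbc
  refine hfree (isIndContained_of_lt ![a, c, d, b] ?_ ?_)
  · simp [Fin.forall_fin_succ, hab.ne, hbc.ne', hac_ne, hdb_ne, hda_ne.symm, hdc_ne.symm]
  · simp [Fin.forall_fin_succ, triangleWithPendantEdge, hab, hbc.symm, hac, hdb, F.adj_comm _ d,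
      hda, hdc]

end InducedFree

section FiveCycle

variable {V : Type*} {F : SimpleGraph V} {f : Fin 5 → V}

theorem not_adj_add_two (hF : F.CliqueFree 3) (hf : ∀ i, F.Adj (f i) (f (i + 1))) (i : Fin 5) :
    ¬ F.Adj (f i) (f (i + 2)) :=
  not_adj_of_cliqueFree_three hF (hf i) (by simpa [add_assoc] using hf (i + 1))

theorem injective_of_five_cycle (hF : F.CliqueFree 3) (hf : ∀ i, F.Adj (f i) (f (i + 1))) :
    Function.Injective f := by
  have ne_add_two (i : Fin 5) : f i ≠ f (i + 2) := fun h =>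
    not_adj_add_two hF hf (i + 3) <| by simpa [add_assoc, h] using (hf (i + 2)).symm
  have cases_sub : ∀ i j : Fin 5, i = j ∨ j = i + 1 ∨ i = j + 1 ∨ j = i + 2 ∨ i = j + 2 := by
    decide
  intro i j hij
  rcases cases_sub i j with h | rfl | rfl | rfl | rfl
  · exact h
  · exact absurd hij (hf i).ne
  · exact absurd hij (hf j).ne'
  · exact absurd hij (ne_add_two i)
  · exact absurd hij (ne_add_two j).symm

theorem surjective_of_five_cycle (hF : F.CliqueFree 3)
    (hfree : F.InducedFree triangleWithPendantEdgeᶜ) (hf : ∀ i, F.Adj (f i) (f (i + 1))) :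
    Function.Surjective f := by
  rw [Function.Surjective]
  by_contra! ⟨y, hy⟩
  have hf' (i : Fin 5) : F.Adj (f (i + 1)) (f (i + 2)) := by simpa [add_assoc] using hf (i + 1)
  have hinj := injective_of_five_cycle hF hf
  have adj_path (i : Fin 5) : F.Adj y (f i) ∨ F.Adj y (f (i + 1)) ∨ F.Adj y (f (i + 2)) :=
    adj_of_path_two_of_inducedFree_triangleWithPendantEdge_compl hF hfree (hf i) (hf' i)
      (hinj.ne (by simp)) (hy _).symm
  have not_adj_of_adj (i : Fin 5) (h₀ : F.Adj y (f i)) : ¬ F.Adj y (f (i + 2)) := fun h₂ => by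
    rcases adj_of_path_two_of_inducedFree_triangleWithPendantEdge_compl hF hfree h₀ (hf i)
      (hy _).symm (hinj.ne (by simp : i + 3 ≠ i)) with h | h | h
    · exact not_adj_of_cliqueFree_three hF h₂ (by simpa [add_assoc] using hf (i + 2)) h.symm
    · exact not_adj_add_two hF hf (i + 3) (by simpa [add_assoc] using h)
    · exact not_adj_add_two hF hf (i + 1) (by simpa [add_assoc] using h.symm)
  have not_adj (i : Fin 5) : ¬ F.Adj y (f i) := fun h₀ => by
    rcases adj_path (i + 1) with h | h | h
    · exact not_adj_of_cliqueFree_three hF h₀ (hf i) h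
    · exact not_adj_of_adj i h₀ (by simpa [add_assoc] using h)
    · exact not_adj_of_adj _ h (by simpa [add_assoc] using h₀)
  simpa [not_adj] using adj_path 0

theorem colorable_two_or_card_eq_five [Fintype V] (hF : F.CliqueFree 3)
    (hfree : F.InducedFree triangleWithPendantEdgeᶜ) :
    F.Colorable 2 ∨ Fintype.card V = 5 := by
  by_cases hwalk : ∀ a b c d, F.Adj a b → F.Adj b c → F.Adj c d → F.Adj a d
  · exact .inl (colorable_two_of_adj_of_walk_three hwalk)
  push Not at hwalk
  obtain ⟨a, b, c, d, hab, hbc, hcd, had⟩ := hwalk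
  have hac_ne : a ≠ c := by rintro rfl; exact had hcd
  have hbd_ne : b ≠ d := by rintro rfl; exact had hab
  by_cases hx : ∃ x, F.Adj d x ∧ F.Adj x a
  · obtain ⟨x, hdx, hxa⟩ := hx
    have hf : ∀ i, F.Adj (![a, b, c, d, x] i) (![a, b, c, d, x] (i + 1)) := by
      simp [Fin.forall_fin_succ, hab, hbc, hcd, hdx, hxa]
    exact .inr (Fintype.card_of_bijective ⟨injective_of_five_cycle hF hf,
      surjective_of_five_cycle hF hfree hf⟩).symm
  · refine .inl (colorable_two_of_forall_adj_or_adj hF (b := b) (c := c) fun x => ?_)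
    have habc (hxb : x ≠ b) := adj_of_path_two_of_inducedFree_triangleWithPendantEdge_compl
      hF hfree hab hbc hac_ne hxb
    have hbcd (hxc : x ≠ c) := adj_of_path_two_of_inducedFree_triangleWithPendantEdge_compl
      hF hfree hbc hcd hbd_ne hxc
    grind [F.adj_comm]

end FiveCycle

theorem mainTheorem7 {V : Type*} [Fintype V] (G : SimpleGraph V) (hα : G.indepNum ≤ 2)
    (hfree : G.InducedFree (SimpleGraph.pathGraph 4) ∨ G.InducedFree triangleWithPendantEdge) :
    G.ContainsImmersion (SimpleGraph.completeGraph (Fin ⌈(Fintype.card V : ℚ) / 2⌉₊)) := by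
  have hF : Gᶜ.CliqueFree 3 := cliqueFree_of_cliqueNum_lt (by simpa using Nat.lt_succ_of_le hα)
  have of_colorable (hcol : Gᶜ.Colorable 2) :
      G.ContainsImmersion (completeGraph (Fin ⌈(Fintype.card V : ℚ) / 2⌉₊)) := by
    refine containsImmersion_of_isContained (completeGraph_isContained_of_le_cliqueNum ?_)
    have hcard : (Fintype.card V : ℚ) ≤ 2 * G.cliqueNum := by
      exact_mod_cast indepNum_compl (G := G) ▸ card_le_mul_indepNum_of_colorable hcol
    exact Nat.ceil_le.mpr (by linarith)
  rcases hfree with hfree | hfree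
  · have hfree' : Gᶜ.InducedFree (pathGraph 4) := fun h =>
      inducedFree_compl_compl_iff.mpr hfree (pathGraph_four_compl_isIndContained.trans h)
    exact of_colorable <| colorable_two_of_adj_of_walk_three <|
      adj_of_walk_three_of_inducedFree_pathGraph hF hfree'
  · rcases colorable_two_or_card_eq_five hF (inducedFree_compl_compl_iff.mpr hfree) with
      hcol | hcard
    · exact of_colorable hcol
    · have hceil : ⌈(Fintype.card V : ℚ) / 2⌉₊ = 3 := by
        rw [hcard]
        norm_num [Nat.ceil_eq_iff]
      have hcyclic : ¬ G.IsAcyclic := fun hG => by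
        have := card_le_mul_indepNum_of_colorable hG.colorable_two
        lia
      exact hceil ▸ containsImmersion_completeGraph_three_of_not_isAcyclic hcyclic
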